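/- **Setting.** Let $\mathcal X\subseteq\mathbb R^n$, let $\mathcal U\subseteq\mathbb R^m$ be nonempty, closed and convex, and consider $\dot x=f(x)+G(x)u$ with $x\in\mathcal X$, $u\in\mathcal U$, where $(f,G)$ is piecewise continuous: there are pairwise disjoint open sets $\mathcal X_1,\dots,\mathcal X_\omega\subseteq\mathcal X$ with $\mathcal X\subseteq\overline{\bigcup_j\mathcal X_j}$ and continuous maps $f_j:\mathcal X\to\mathbb R^n$, $G_j:\mathcal X\to\mathbb R^{n\times m}$ with $(f,G)=(f_j,G_j)$ on $\mathcal X_j$. Let $\mathcal J(x)=\{j: x\in\overline{\mathcal X_j}\}$, and assume that for every $x\in\mathcal X$ there is $j\in\mathcal J(x)$ with $(f(x),G(x))=(f_j(x),G_j(x))$. Let $h_1,\dots,h_r$ be real functions on $\mathcal X$ of class $C^1$ (on an open set containing $\mathcal X$, if $\mathcal X$ is not open) such that, for $i\ne i'$, $h_i(x)\neq h_{i'}(x)$ for almost all $x\in\mathcal X$. Let $\mathcal L$ be a nonempty finite set, let $\mathcal I^\ell\subseteq\{1,\dots,r\}$ be nonempty for $\ell\in\mathcal L$, and put $$h^\ell(x)=\min_{i\in\mathcal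 I^\ell}h_i(x),\qquad h(x)=\max_{\ell\in\mathcal L}h^\ell(x),\qquad \mathcal C=\bigcup_{\ell\in\mathcal L}\bigcap_{i\in\mathcal I^\ell}\{x\in\mathcal X: h_i(x)\ge 0\}=\{x\in\mathcal X: h(x)\ge0\}.$$ (Every set obtained from the sets $\{h_i\ge0\}$ by finitely many nested unions and intersections has this form.) Assume that $\partial\mathcal C$ is compact and that every $x\in\mathcal X$ with $h(x)=0$ lies in $\partial\mathcal C$. Let $\tilde{\mathcal I}(x)=\{i: \exists\,\ell\in\mathcal L,\ i\in\mathcal I^\ell,\ h(x)=h^\ell(x)=h_i(x)\}$, and assume that for every $x\in\partial\mathcal C\cap\mathcal X$ there is $u_x\in\mathcal U$ with $$\nabla h_i(x)^\top\big(f_j(x)+G_j(x)u_x\big)>0\qquad\text{for all } i\in\tilde{\mathcal I}(x),\ j\in\mathcal J(x).$$ Let $Q:\mathcal X\to\mathbb R^{m\times m}$ and $b:\mathcal X\to\mathbb R^m$ be Lipschitz with $Q(x)$ positive definite for all $x \in \mathcal X$, and let $q_\alpha,q_M,c_\alpha,c_M>0$. For $x\in\mathcal X$, the *all-components adaptive QP*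 is the program, in the variables $(u,\alpha,M)\in\mathcal U\times\mathbb R\times\mathbb R$, $$\min\ u^\top Q(x)u+b(x)^\top u+q_\alpha\alpha^2+q_MM^2$$ subject to $M\ge c_M$, $\alpha\ge c_\alpha$ and $$\nabla h_i(x)^\top\big(f(x)+G(x)u\big)+\alpha h_i(x)+M\big(h(x)-h^\ell(x)\big)\ge0\qquad\text{for all }\ell\in\mathcal L,\ i\in\mathcal I^\ell.$$ For a vector field $V:\mathcal X\to\mathbb R^n$ let $F[V](x)=\bigcap_{\delta>0}\bigcap_{S}\overline{\mathrm{co}}\,V\big((B_\delta(x)\cap\mathcal X)\setminus S\big)$, where $S$ runs over the Lebesgue null sets. A *Filippov solution* of $\dot x=V(x)$ is an absolutely continuous $\varphi:[t_0,t_1]\to\mathcal X$, $t_0<t_1$, with $\dot\varphi(t)\in F[V](\varphi(t))$ for almost all $t$. **Theorem.** For every compact $\mathcal D\subseteq\mathcal C$ there is an open set $\mathcal N\supseteq\mathcal D$ such that: 1. (feasible) for every $x\in\mathcal N\cap\mathcal X$ the adaptive QP at $x$ is feasible; 2. (single-valued) for every $x\in\mathcal N\cap\mathcal X$ the adaptive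 QP at $x$ has exactly one minimizer $(u_{\mathrm{adp}}(x),\alpha_{\mathrm{adp}}(x),M_{\mathrm{adp}}(x))$; and, for every feedback $k:\mathcal X\to\mathbb R^m$ with $k=u_{\mathrm{adp}}$ on $\mathcal N\cap\mathcal X$: 3. (continuous) $k$ is continuous at every $x\in\mathcal N\cap\mathcal X$ at which $f$ and $G$ are continuous (continuity being relative to $\mathcal X$); 4. (safe) no Filippov solution of $\dot x=f(x)+G(x)k(x)$ leaves $\mathcal C$ from a point of $\mathcal D$: if $\varphi:[t_0,t_1]\to\mathcal X$ is a Filippov solution and $\varphi(t)\in\mathcal D$ for some $t\in[t_0,t_1)$, then there is $\varepsilon>0$ with $\varphi(s)\in\mathcal C$ for all $s\in(t,t+\varepsilon)\cap[t_0,t_1]$. -/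

import Mathlib

open Set Filter Topology MeasureTheory

namespace AdaptiveQP

/-- The Euclidean space `ℝⁿ`. -/
abbrev E (n : ℕ) : Type := EuclideanSpace ℝ (Fin n)

/-- A control-affine system `ẋ = f(x) + G(x) u` with state in `X ⊆ ℝⁿ` and input in a nonempty
closed convex set `U ⊆ ℝᵐ`, whose data `(f, G)` is piecewise continuous: there are finitely many
disjoint open sets `X_j ⊆ X` whose union is dense in `X`, and continuous maps `(f_j, G_j)` on `X`
such that `(f, G) = (f_j, G_j)` on `X_j`, and at each point of `X` the pair `(f, G)` takes the
value of one of the active pieces. Matrices are identified with the linear maps they represent. -/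
structure PiecewiseSystem (n m ω : ℕ) where
  X : Set (E n)
  U : Set (E m)
  f : E n → E n
  G : E n → E m →L[ℝ] E n
  /-- the open sets `X_j` -/
  region : Fin ω → Set (E n)
  /-- the continuous maps `f_j` -/
  fPiece : Fin ω → E n → E n
  /-- the continuous maps `G_j` -/
  GPiece : Fin ω → E n → E m →L[ℝ] E n
  U_nonempty : U.Nonempty
  U_closed : IsClosed U
  U_convex : Convex ℝ U
  region_open : ∀ j, IsOpen (region j)
  region_disjoint : Pairwise fun i j => Disjoint (region i) (region j)
  region_subset : ∀ j, region j ⊆ X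
  region_dense : X ⊆ closure (⋃ j, region j)
  fPiece_continuous : ∀ j, ContinuousOn (fPiece j) X
  GPiece_continuous : ∀ j, ContinuousOn (GPiece j) X
  eq_on_region : ∀ j, ∀ x ∈ region j, f x = fPiece j x ∧ G x = GPiece j x
  eq_active : ∀ x ∈ X, ∃ j, x ∈ closure (region j) ∧ f x = fPiece j x ∧ G x = GPiece j x

/-- The set `J(x)` of dynamics that are active at `x`. -/
def PiecewiseSystem.activeDyn {n m ω : ℕ} (S : PiecewiseSystem n m ω) (x : E n) : Set (Fin ω) :=
  {j | x ∈ closure (S.region j)}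

/-- Data of a set given by a finite union over `ℓ ∈ L` of finite intersections over `i ∈ I^ℓ` of
`0`-superlevel sets of components `h_i`, `i ∈ {1, …, r}`. The components are continuously
differentiable on `X` (in a neighbourhood of `X`, when `X` is not open), and any two of them differ
almost everywhere in `X`. -/
structure Components (n r : ℕ) (L : Type*) (X : Set (E n)) where
  h : Fin r → E n → ℝ
  /-- the index sets `I^ℓ` -/
  I : L → Finset (Fin r)
  I_nonempty : ∀ l, (I l).Nonempty
  contDiff : ∀ i, ∃ W, IsOpen W ∧ X ⊆ W ∧ ContDiffOn ℝ 1 (h i) W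
  ae_ne : ∀ i i', i ≠ i' → ∀ᵐ x, x ∈ X → h i x ≠ h i' x

namespace Components

variable {n r : ℕ} {L : Type*} {X : Set (E n)}

/-- `h^ℓ(x) = min_{i ∈ I^ℓ} h_i(x)`. -/
noncomputable def hMin (c : Components n r L X) (l : L) (x : E n) : ℝ :=
  (c.I l).inf' (c.I_nonempty l) fun i => c.h i x

/-- `h(x) = max_{ℓ ∈ L} min_{i ∈ I^ℓ} h_i(x)`. -/
noncomputable def hMax [Fintype L] [Nonempty L] (c : Components n r L X) (x : E n) : ℝ :=
  Finset.univ.sup' Finset.univ_nonempty fun l => c.hMin l x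

/-- The component set `C_i`, the `0`-superlevel set of `h_i`. -/
def compSet (c : Components n r L X) (i : Fin r) : Set (E n) := {x ∈ X | 0 ≤ c.h i x}

/-- The safe set `C = ⋃_{ℓ ∈ L} ⋂_{i ∈ I^ℓ} C_i`. -/
def safeSet (c : Components n r L X) : Set (E n) := ⋃ l, ⋂ i ∈ c.I l, c.compSet i

/-- The safe set is the `0`-superlevel set of `h`. -/
theorem mem_safeSet [Fintype L] [Nonempty L] (c : Components n r L X) (x : E n) :
    x ∈ c.safeSet ↔ x ∈ X ∧ 0 ≤ c.hMax x := by
  simp only [safeSet, compSet, hMax, hMin, mem_iUnion, mem_iInter, mem_ofPred_eq,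
    Finset.le_sup'_iff, Finset.le_inf'_iff, Finset.mem_univ, true_and]
  constructor
  · rintro ⟨l, hl⟩
    obtain ⟨i, hi⟩ := c.I_nonempty l
    exact ⟨(hl i hi).1, l, fun i hi => (hl i hi).2⟩
  · rintro ⟨hx, l, hl⟩
    exact ⟨l, fun i hi => ⟨hx, hl i hi⟩⟩

/-- The enlarged set of active components
`Ĩ(x) = {i | ∃ ℓ, i ∈ I^ℓ and h(x) = h^ℓ(x) = h_i(x)}`. -/
def activeComp [Fintype L] [Nonempty L] (c : Components n r L X) (x : E n) : Set (Fin r) :=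
  {i | ∃ l, i ∈ c.I l ∧ c.hMax x = c.hMin l x ∧ c.hMin l x = c.h i x}

/-- The nonsmooth CBF condition: at each boundary point of the safe set there is an admissible
input under which all active components strictly increase for all active dynamics. -/
def CBFCondition [Fintype L] [Nonempty L] {m ω : ℕ} (S : PiecewiseSystem n m ω)
    (c : Components n r L S.X) : Prop :=
  ∀ x ∈ S.X, x ∈ frontier c.safeSet →
    ∃ u ∈ S.U, ∀ i ∈ c.activeComp x, ∀ j ∈ S.activeDyn x,
      0 < inner ℝ (gradient (c.h i) x) (S.fPiece j x + S.GPiece j x u)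

end Components

/-- The parameters of the objective function and of the constraints: `Q` and `b` are Lipschitz
on `X`, `Q(x)` is positive definite, and `q_α, q_M, c_α, c_M` are positive constants. -/
structure QPParams (n m : ℕ) (X : Set (E n)) where
  Q : E n → E m →L[ℝ] E m
  b : E n → E m
  qα : ℝ
  qM : ℝ
  cα : ℝ
  cM : ℝ
  Q_lipschitz : ∃ K, LipschitzOnWith K Q X
  b_lipschitz : ∃ K, LipschitzOnWith K b X
  Q_posDef : ∀ x ∈ X, ∀ u, u ≠ 0 → 0 < inner ℝ u (Q x u)
  qα_pos : 0 < qα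
  qM_pos : 0 < qM
  cα_pos : 0 < cα
  cM_pos : 0 < cM

section QP

variable {n m ω r : ℕ} {L : Type*} [Fintype L] [Nonempty L]

/-- The objective `uᵀ Q(x) u + b(x)ᵀ u + q_α α² + q_M M²` at `z = (u, α, M)`. -/
noncomputable def objective {X : Set (E n)} (p : QPParams n m X) (x : E n) (z : E m × ℝ × ℝ) : ℝ :=
  inner ℝ z.1 (p.Q x z.1) + inner ℝ (p.b x) z.1 + p.qα * z.2.1 ^ 2 + p.qM * z.2.2 ^ 2

/-- The feasible set of the adaptive program at the state `x`: the triples `z = (u, α, M)` with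
`u ∈ U`, `α ≥ c_α`, `M ≥ c_M` and
`∇h_i(x)ᵀ (f(x) + G(x) u) + α h_i(x) + M (h(x) - h^ℓ(x)) ≥ 0` for all `ℓ ∈ L`, `i ∈ I^ℓ`. -/
def feasibleSet (S : PiecewiseSystem n m ω) (c : Components n r L S.X) (p : QPParams n m S.X)
    (x : E n) : Set (E m × ℝ × ℝ) :=
  {z | z.1 ∈ S.U ∧ p.cα ≤ z.2.1 ∧ p.cM ≤ z.2.2 ∧
    ∀ l, ∀ i ∈ c.I l,
      0 ≤ inner ℝ (gradient (c.h i) x) (S.f x + S.G x z.1) + z.2.1 * c.h i x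
        + z.2.2 * (c.hMax x - c.hMin l x)}

/-- The set of solutions `(u, α, M)` of the adaptive program at the state `x`. -/
def solutionSet (S : PiecewiseSystem n m ω) (c : Components n r L S.X) (p : QPParams n m S.X)
    (x : E n) : Set (E m × ℝ × ℝ) :=
  {z ∈ feasibleSet S c p x | ∀ z' ∈ feasibleSet S c p x, objective p x z ≤ objective p x z'}

/-- The feedback `k` is the adaptive controller on the set `A`: at each state of `A`, its value is
the `u`-part of a solution of the adaptive program. -/
def IsAdaptiveController (S : PiecewiseSystem n m ω) (c : Components n r L S.X)
    (p : QPParams n m S.X) (A : Set (E n)) (k : E n → E m) : Prop :=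
  ∀ x ∈ A, ∃ α M : ℝ, (k x, α, M) ∈ solutionSet S c p x

end QP

/-- The Filippov set-valued map of a vector field `V : X → ℝⁿ`, `X ⊆ ℝⁿ`. -/
def filippovMap {n : ℕ} (X : Set (E n)) (V : E n → E n) (x : E n) : Set (E n) :=
  ⋂ (δ : ℝ) (_ : 0 < δ) (N : Set (E n)) (_ : volume N = 0),
    closure (convexHull ℝ (V '' ((Metric.ball x δ ∩ X) \ N)))

/-- `φ : [t₀, t₁] → X` is a Filippov solution of `ẋ = V(x)`: it is absolutely continuous and
`φ'(t)` lies in the Filippov map of `V` at `φ(t)` for almost all `t`. -/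
structure IsFilippovSolution {n : ℕ} (X : Set (E n)) (V : E n → E n) (φ : ℝ → E n)
    (t₀ t₁ : ℝ) : Prop where
  lt : t₀ < t₁
  mem : ∀ t ∈ Icc t₀ t₁, φ t ∈ X
  absolutelyContinuous : AbsolutelyContinuousOnInterval φ t₀ t₁
  deriv_mem : ∀ᵐ t, t ∈ Icc t₀ t₁ → ∃ v ∈ filippovMap X V (φ t), HasDerivAt φ v t

/-- The curve `φ` leaves the set `C` at time `t`: there are times arbitrarily close after `t`
at which `φ` is outside `C`. -/
def LeavesAt {n : ℕ} (φ : ℝ → E n) (C : Set (E n)) (t : ℝ) : Prop :=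
  ∃ᶠ s in 𝓝[>] t, φ s ∉ C

end AdaptiveQP

/-! Strict feasibility is the central notion: a triple `(u, α, M)` satisfying the constraints
strictly for every active piece of the dynamics. One exists at each point of the safe set
(`exists_strictlyFeasible`) and persists nearby (`StrictlyFeasible.eventually`), which yields the
neighbourhood. There the objective is coercive and strictly convex on a nonempty closed convex set,
so the minimizer is unique. Minimizers are locally bounded, by comparison with the strictly feasible
triple; where `f` and `G` are continuous, compactness and perturbation towards that triple make them
continuous.

Safety is a statement about points with `h < 0`. For a component `i ∈ I^ℓ` active at such a point,
the constraint gives `∇h_i · V ≥ -α h_i - M (h - h^ℓ)` nearby. The first term on the right is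
nonnegative whatever the size of `α`, and the second tends to zero because `M` is locally bounded.
Hence every Filippov velocity has nonnegative product with `∇h_i`
(`StrictlyFeasible.inner_gradient_nonneg`). Along a solution, `h` is absolutely continuous and its
derivative, where it exists, is that of an active component
(`Components.exists_activeComp_hasDerivAt`), so `h` cannot decrease while negative and never becomes
negative. -/

/-! ### Lipschitz and absolutely continuous functions -/

section Lattice

variable {α ι : Type*} [PseudoMetricSpace α]

theorem LipschitzOnWith.finset_sup' {K : NNReal} {A : Set α} {s : Finset ι} (hs : s.Nonempty)
    {f : ι → α → ℝ} (hf : ∀ i ∈ s, LipschitzOnWith K (f i) A) :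
    LipschitzOnWith K (fun x => s.sup' hs fun i => f i x) A := by
  refine LipschitzOnWith.of_le_add_mul K fun x hx y hy => Finset.sup'_le _ _ fun i hi => ?_
  have h1 := (hf i hi).le_add_mul hx hy
  have h2 := Finset.le_sup' (fun i => f i y) hi
  linarith

theorem LipschitzOnWith.finset_inf' {K : NNReal} {A : Set α} {s : Finset ι} (hs : s.Nonempty)
    {f : ι → α → ℝ} (hf : ∀ i ∈ s, LipschitzOnWith K (f i) A) :
    LipschitzOnWith K (fun x => s.inf' hs fun i => f i x) A := by
  refine LipschitzOnWith.of_le_add_mul K fun x hx y hy => ?_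
  rw [← sub_le_iff_le_add]
  refine Finset.le_inf' _ _ fun i hi => ?_
  have h1 := (hf i hi).le_add_mul hx hy
  have h2 := Finset.inf'_le (fun i => f i x) hi
  linarith

end Lattice

/-- Composition with a Lipschitz map preserves absolute continuity. -/
theorem LipschitzOnWith.comp_absolutelyContinuousOnInterval {X Y : Type*} [PseudoMetricSpace X]
    [PseudoMetricSpace Y] {K : NNReal} {g : X → Y} {A : Set X} (hg : LipschitzOnWith K g A)
    {φ : ℝ → X} {a b : ℝ} (hφ : AbsolutelyContinuousOnInterval φ a b)
    (hA : MapsTo φ (uIcc a b) A) : AbsolutelyContinuousOnInterval (g ∘ φ) a b := by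
  rw [absolutelyContinuousOnInterval_iff] at hφ ⊢
  intro ε hε
  -- Dividing by `K + 1` covers the case `K = 0`.
  obtain ⟨δ, hδ, H⟩ := hφ (ε / (K + 1)) (by positivity)
  refine ⟨δ, hδ, fun J hJ hlen => ?_⟩
  have h1 := H J hJ hlen
  calc ∑ i ∈ Finset.range J.1, dist ((g ∘ φ) (J.2 i).1) ((g ∘ φ) (J.2 i).2)
      ≤ ∑ i ∈ Finset.range J.1, K * dist (φ (J.2 i).1) (φ (J.2 i).2) := by
        refine Finset.sum_le_sum fun i hi => ?_
        have h2 := hJ.1 i hi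
        exact hg.dist_le_mul _ (hA h2.1) _ (hA h2.2)
    _ = K * ∑ i ∈ Finset.range J.1, dist (φ (J.2 i).1) (φ (J.2 i).2) := by
        rw [Finset.mul_sum]
    _ ≤ K * (ε / (K + 1)) := by gcongr
    _ < ε := by
        rw [mul_div_assoc', div_lt_iff₀ (by positivity)]
        nlinarith

/-- An absolutely continuous function whose derivative is nonnegative almost everywhere does not
decrease. -/
theorem AbsolutelyContinuousOnInterval.le_of_ae_deriv_nonneg {g : ℝ → ℝ} {a b : ℝ} (hab : a ≤ b)
    (hg : AbsolutelyContinuousOnInterval g a b)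
    (h : ∀ᵐ s, s ∈ Ioo a b → 0 ≤ deriv g s) : g a ≤ g b := by
  have h1 := hg.integral_deriv_eq_sub
  have h2 : 0 ≤ ∫ s in a..b, deriv g s := by
    refine intervalIntegral.integral_nonneg_of_ae_restrict hab ?_
    rw [← Measure.restrict_congr_set Ioo_ae_eq_Icc]
    exact (ae_restrict_iff' measurableSet_Ioo).2 h
  linarith

/-! ### Regularity of the max-min function `h` -/

namespace AdaptiveQP

namespace Components

variable {n r : ℕ} {L : Type*} {X : Set (E n)} (c : Components n r L X)

theorem contDiffAt {x : E n} (hx : x ∈ X) (i : Fin r) : ContDiffAt ℝ 1 (c.h i) x := by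
  obtain ⟨W, hW, hXW, hc⟩ := c.contDiff i
  exact hc.contDiffAt (hW.mem_nhds (hXW hx))

theorem continuousAt_h {x : E n} (hx : x ∈ X) (i : Fin r) : ContinuousAt (c.h i) x :=
  (c.contDiffAt hx i).continuousAt

theorem hasGradientAt {x : E n} (hx : x ∈ X) (i : Fin r) :
    HasGradientAt (c.h i) (gradient (c.h i) x) x :=
  ((c.contDiffAt hx i).differentiableAt one_ne_zero).hasGradientAt

theorem continuousAt_gradient {x : E n} (hx : x ∈ X) (i : Fin r) :
    ContinuousAt (gradient (c.h i)) x := by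
  have h := (c.contDiffAt hx i).fderiv_right (m := 0) (by simp)
  exact (InnerProductSpace.toDual ℝ (E n)).symm.continuous.continuousAt.comp h.continuousAt

theorem continuousAt_hMin {x : E n} (hx : x ∈ X) (l : L) : ContinuousAt (c.hMin l) x :=
  ContinuousAt.finset_inf'_apply _ fun i _ => c.continuousAt_h hx i

theorem hMin_le {l : L} {i : Fin r} (hi : i ∈ c.I l) (x : E n) : c.hMin l x ≤ c.h i x :=
  Finset.inf'_le (fun i => c.h i x) hi

variable [Fintype L] [Nonempty L]

theorem continuousAt_hMax {x : E n} (hx : x ∈ X) : ContinuousAt c.hMax x :=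
  ContinuousAt.finset_sup'_apply _ fun l _ => c.continuousAt_hMin hx l

theorem hMin_le_hMax (l : L) (x : E n) : c.hMin l x ≤ c.hMax x :=
  Finset.le_sup' (fun l => c.hMin l x) (Finset.mem_univ l)

theorem exists_active (x : E n) :
    ∃ l, ∃ i ∈ c.I l, c.hMax x = c.hMin l x ∧ c.hMin l x = c.h i x := by
  obtain ⟨l, -, hl⟩ := Finset.exists_mem_eq_sup' Finset.univ_nonempty fun l => c.hMin l x
  obtain ⟨i, hi, hi'⟩ := Finset.exists_mem_eq_inf' (c.I_nonempty l) fun i => c.h i x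
  exact ⟨l, i, hi, hl, hi'⟩

theorem exists_lipschitzOnWith_hMax {x : E n} (hx : x ∈ X) :
    ∃ K, ∃ A ∈ 𝓝 x, LipschitzOnWith K c.hMax A := by
  choose K A hA hKA using fun i => (c.contDiffAt hx i).exists_lipschitzOnWith
  refine ⟨Finset.univ.sup K, ⋂ i, A i, iInter_mem.2 hA, ?_⟩
  exact LipschitzOnWith.finset_sup' _ fun l _ => LipschitzOnWith.finset_inf' _ fun i _ =>
    ((hKA i).mono (iInter_subset _ i)).weaken (Finset.le_sup (Finset.mem_univ i))

/-- Where `h` is differentiable along a curve, its derivative is that of an active component. -/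
theorem exists_activeComp_hasDerivAt {φ : ℝ → E n} {s g' : ℝ} {v : E n}
    (hX : φ s ∈ X) (hφ : HasDerivAt φ v s) (hg : HasDerivAt (c.hMax ∘ φ) g' s) :
    ∃ i ∈ c.activeComp (φ s), g' = inner ℝ (gradient (c.h i) (φ s)) v := by
  -- Pigeonhole: there are finitely many pairs `(ℓ, i)`, so a single one realizes `h` at times
  -- accumulating at `s`. By continuity it does so at `s` as well, and the difference quotients of
  -- `h ∘ φ` and `h_i ∘ φ` agree along these times.
  have hfr : ∃ᶠ w in 𝓝[≠] s, ∃ q : L × Fin r, q.2 ∈ c.I q.1 ∧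
      c.hMax (φ w) = c.hMin q.1 (φ w) ∧ c.hMin q.1 (φ w) = c.h q.2 (φ w) := by
    refine Eventually.frequently (Eventually.of_forall fun w => ?_)
    obtain ⟨l, i, hi, h1, h2⟩ := c.exists_active (φ w)
    exact ⟨(l, i), hi, h1, h2⟩
  rw [frequently_exists] at hfr
  obtain ⟨⟨l, i⟩, hli⟩ := hfr
  have hi : i ∈ c.I l := hli.exists.choose_spec.1
  have hφc : Tendsto φ (𝓝[≠] s) (𝓝 (φ s)) := hφ.continuousAt.tendsto.mono_left nhdsWithin_le_nhds
  have hM := (c.continuousAt_hMax hX).tendsto.comp hφc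
  have hm := (c.continuousAt_hMin hX l).tendsto.comp hφc
  have hh := (c.continuousAt_h hX i).tendsto.comp hφc
  have e1 : c.hMax (φ s) = c.hMin l (φ s) :=
    tendsto_nhds_unique_of_frequently_eq hM hm (hli.mono fun w hw => hw.2.1)
  have e2 : c.hMin l (φ s) = c.h i (φ s) :=
    tendsto_nhds_unique_of_frequently_eq hm hh (hli.mono fun w hw => hw.2.2)
  refine ⟨i, ⟨l, hi, e1, e2⟩, ?_⟩
  have hd : HasDerivAt (c.h i ∘ φ) (inner ℝ (gradient (c.h i) (φ s)) v) s := by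
    have := (c.hasGradientAt hX i).hasFDerivAt.comp_hasDerivAt s hφ
    simpa using this
  refine tendsto_nhds_unique_of_frequently_eq hg.tendsto_slope hd.tendsto_slope
    (hli.mono fun w hw => ?_)
  simp only [slope_def_field, Function.comp_apply]
  rw [e1, hw.2.1, hw.2.2, e2]

end Components

end AdaptiveQP

/-! ### Strictly feasible triples -/

namespace AdaptiveQP

theorem tendsto_clm_apply {ι V W : Type*} [NormedAddCommGroup V] [NormedSpace ℝ V]
    [NormedAddCommGroup W] [NormedSpace ℝ W] {F : Filter ι} {A : ι → V →L[ℝ] W} {A₀ : V →L[ℝ] W}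
    {v : ι → V} {v₀ : V} (hA : Tendsto A F (𝓝 A₀)) (hv : Tendsto v F (𝓝 v₀)) :
    Tendsto (fun y => A y (v y)) F (𝓝 (A₀ v₀)) :=
  ((continuous_fst.clm_apply continuous_snd).tendsto (A₀, v₀)).comp (hA.prodMk_nhds hv)

variable {n m ω r : ℕ} {L : Type*} [Fintype L] [Nonempty L]

section Slater

variable (S : PiecewiseSystem n m ω) (c : Components n r L S.X) (p : QPParams n m S.X)

/-- The triple `z = (u, α, M)` satisfies the constraints at `x` strictly for all active dynamics. -/
def StrictlyFeasible (x : E n) (z : E m × ℝ × ℝ) : Prop :=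
  z.1 ∈ S.U ∧ p.cα ≤ z.2.1 ∧ p.cM ≤ z.2.2 ∧
    ∀ j ∈ S.activeDyn x, ∀ l, ∀ i ∈ c.I l,
      0 < inner ℝ (gradient (c.h i) x) (S.fPiece j x + S.GPiece j x z.1) + z.2.1 * c.h i x
        + z.2.2 * (c.hMax x - c.hMin l x)

variable {S c p}

/-- A large `α` settles the components with `h_i > 0`, and then a large `M`, depending on `α`,
settles every `ℓ` with `h^ℓ < h`. What remains is `h = h^ℓ = h_i = 0`, where the CBF input works. -/
theorem exists_strictlyFeasible (hzero : ∀ x ∈ S.X, c.hMax x = 0 → x ∈ frontier c.safeSet)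
    (hcbf : Components.CBFCondition S c) {x : E n} (hx : x ∈ c.safeSet) :
    ∃ z, StrictlyFeasible S c p x z := by
  obtain ⟨hxX, hnn⟩ := (c.mem_safeSet x).1 hx
  obtain ⟨u, hu, hu0⟩ : ∃ u ∈ S.U, c.hMax x = 0 → ∀ i ∈ c.activeComp x, ∀ j ∈ S.activeDyn x,
      0 < inner ℝ (gradient (c.h i) x) (S.fPiece j x + S.GPiece j x u) := by
    by_cases h0 : c.hMax x = 0
    · obtain ⟨u, hu, hu'⟩ := hcbf x hxX (hzero x hxX h0)
      exact ⟨u, hu, fun _ => hu'⟩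
    · obtain ⟨u, hu⟩ := S.U_nonempty
      exact ⟨u, hu, fun h => absurd h h0⟩
  have key : ∀ a d : ℝ, 0 < d → ∀ᶠ t in atTop, 0 < a + t * d := fun a d hd =>
    (tendsto_atTop_add_const_left _ a (tendsto_id.atTop_mul_const hd)).eventually_gt_atTop 0
  have hα : ∀ᶠ α : ℝ in atTop, ∀ i j, 0 < c.h i x →
      0 < inner ℝ (gradient (c.h i) x) (S.fPiece j x + S.GPiece j x u) + α * c.h i x := by
    refine eventually_all.2 fun i => eventually_all.2 fun j => ?_
    by_cases hi : 0 < c.h i x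
    · exact (key _ _ hi).mono fun _ h _ => h
    · exact Eventually.of_forall fun _ h => absurd h hi
  obtain ⟨α, hα, hcα⟩ := (hα.and (eventually_ge_atTop p.cα)).exists
  have hM : ∀ᶠ M : ℝ in atTop, ∀ l i j, 0 < c.hMax x - c.hMin l x →
      0 < inner ℝ (gradient (c.h i) x) (S.fPiece j x + S.GPiece j x u) + α * c.h i x
        + M * (c.hMax x - c.hMin l x) := by
    refine eventually_all.2 fun l => eventually_all.2 fun i => eventually_all.2 fun j => ?_
    by_cases hl : 0 < c.hMax x - c.hMin l x
    · exact (key _ _ hl).mono fun _ h _ => h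
    · exact Eventually.of_forall fun _ h => absurd h hl
  obtain ⟨M, hM, hcM⟩ := (hM.and (eventually_ge_atTop p.cM)).exists
  refine ⟨(u, α, M), hu, hcα, hcM, fun j hj l i hi => ?_⟩
  by_cases hl : 0 < c.hMax x - c.hMin l x
  · exact hM l i j hl
  have hle := c.hMin_le_hMax l x
  have hle' := c.hMin_le hi x
  have heq : c.hMax x = c.hMin l x := by linarith
  by_cases hi0 : 0 < c.h i x
  · simpa [heq] using hα i j hi0
  · have hi1 : c.h i x = 0 := by linarith
    have hm0 : c.hMin l x = 0 := by linarith
    have hm : c.hMax x = 0 := by linarith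
    simpa [hm, hi1, hm0] using hu0 hm i ⟨l, hi, heq, by rw [hm0, hi1]⟩ j hj

/-- The filter and the field `V` are arbitrary, to serve both the pieces near `x` and the closed
loop along an ultrafilter. -/
theorem tendsto_constraint {x : E n} (hx : x ∈ S.X) {l : L} {i : Fin r}
    {V : E n → E n} {a M : E n → ℝ} {F : Filter (E n)} (hF : F ≤ 𝓝 x) {v : E n} {a₀ M₀ : ℝ}
    (hV : Tendsto V F (𝓝 v)) (ha : Tendsto a F (𝓝 a₀)) (hM : Tendsto M F (𝓝 M₀)) :
    Tendsto (fun y => inner ℝ (gradient (c.h i) y) (V y) + a y * c.h i y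
      + M y * (c.hMax y - c.hMin l y)) F
      (𝓝 (inner ℝ (gradient (c.h i) x) v + a₀ * c.h i x + M₀ * (c.hMax x - c.hMin l x))) :=
  ((((c.continuousAt_gradient hx i).tendsto.mono_left hF).inner hV).add
    (ha.mul ((c.continuousAt_h hx i).tendsto.mono_left hF))).add
    (hM.mul (((c.continuousAt_hMax hx).tendsto.mono_left hF).sub
      ((c.continuousAt_hMin hx l).tendsto.mono_left hF)))

/-- Finitely many strict inequalities between continuous functions persist, and no new piece becomes
active nearby because the closures of the regions are closed. -/
theorem StrictlyFeasible.eventually {x : E n} (hx : x ∈ S.X) {z : E m × ℝ × ℝ}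
    (hz : StrictlyFeasible S c p x z) : ∀ᶠ y in 𝓝[S.X] x, StrictlyFeasible S c p y z := by
  obtain ⟨h1, h2, h3, h4⟩ := hz
  have : ∀ᶠ y in 𝓝[S.X] x, ∀ j, j ∈ S.activeDyn y → ∀ l, ∀ i ∈ c.I l,
      0 < inner ℝ (gradient (c.h i) y) (S.fPiece j y + S.GPiece j y z.1) + z.2.1 * c.h i y
        + z.2.2 * (c.hMax y - c.hMin l y) := by
    refine eventually_all.2 fun j => ?_
    by_cases hj : j ∈ S.activeDyn x
    · have : ∀ᶠ y in 𝓝[S.X] x, ∀ l, ∀ i, i ∈ c.I l →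
          0 < inner ℝ (gradient (c.h i) y) (S.fPiece j y + S.GPiece j y z.1) + z.2.1 * c.h i y
            + z.2.2 * (c.hMax y - c.hMin l y) := by
        refine eventually_all.2 fun l => eventually_all.2 fun i => ?_
        by_cases hi : i ∈ c.I l
        · have := tendsto_constraint (c := c) hx (l := l) (i := i) nhdsWithin_le_nhds
            ((S.fPiece_continuous j x hx).tendsto.add
              (tendsto_clm_apply (S.GPiece_continuous j x hx).tendsto
                (tendsto_const_nhds (x := z.1))))
            (tendsto_const_nhds (x := z.2.1)) (tendsto_const_nhds (x := z.2.2))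
          exact (this.eventually_const_lt (h4 j hj l i hi)).mono fun y hy _ => hy
        · exact Eventually.of_forall fun _ h => absurd h hi
      exact this.mono fun y hy _ => hy
    · have : ∀ᶠ y in 𝓝 x, y ∉ closure (S.region j) :=
        isClosed_closure.isOpen_compl.mem_nhds hj
      exact (this.filter_mono nhdsWithin_le_nhds).mono fun y hy h => absurd h hy
  exact this.mono fun y hy => ⟨h1, h2, h3, hy⟩

/-- Strict feasibility for all active dynamics implies it for the dynamics at the given point. -/
theorem StrictlyFeasible.pos {x : E n} (hx : x ∈ S.X) {z : E m × ℝ × ℝ}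
    (hz : StrictlyFeasible S c p x z) {l : L} {i : Fin r} (hi : i ∈ c.I l) :
    0 < inner ℝ (gradient (c.h i) x) (S.f x + S.G x z.1) + z.2.1 * c.h i x
        + z.2.2 * (c.hMax x - c.hMin l x) := by
  obtain ⟨j, hj, hf, hG⟩ := S.eq_active x hx
  rw [hf, hG]
  exact hz.2.2.2 j hj l i hi

theorem StrictlyFeasible.mem_feasibleSet {x : E n} (hx : x ∈ S.X) {z : E m × ℝ × ℝ}
    (hz : StrictlyFeasible S c p x z) : z ∈ feasibleSet S c p x :=
  ⟨hz.1, hz.2.1, hz.2.2.1, fun _ _ hi => (hz.pos hx hi).le⟩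

end Slater

/-! ### Coercivity and strict convexity of the objective -/

section Objective

variable {X : Set (E n)} (p : QPParams n m X)

theorem tendsto_objective {x : E n} (hx : x ∈ X) {ζ : E n → E m × ℝ × ℝ} {z : E m × ℝ × ℝ}
    {F : Filter (E n)} (hF : F ≤ 𝓝[X] x) (hζ : Tendsto ζ F (𝓝 z)) :
    Tendsto (fun y => objective p y (ζ y)) F (𝓝 (objective p x z)) := by
  obtain ⟨K, hK⟩ := p.Q_lipschitz
  obtain ⟨K', hK'⟩ := p.b_lipschitz
  have hQ : Tendsto p.Q F (𝓝 (p.Q x)) := (hK.continuousOn x hx).tendsto.mono_left hF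
  have hb : Tendsto p.b F (𝓝 (p.b x)) := (hK'.continuousOn x hx).tendsto.mono_left hF
  have h1 : Tendsto (fun y => (ζ y).1) F (𝓝 z.1) := (continuous_fst.tendsto z).comp hζ
  have h2 : Tendsto (fun y => (ζ y).2.1) F (𝓝 z.2.1) :=
    ((continuous_fst.comp continuous_snd).tendsto z).comp hζ
  have h3 : Tendsto (fun y => (ζ y).2.2) F (𝓝 z.2.2) :=
    ((continuous_snd.comp continuous_snd).tendsto z).comp hζ
  exact (((h1.inner (tendsto_clm_apply hQ h1)).add (hb.inner h1)).add ((h2.pow 2).const_mul _)).add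
    ((h3.pow 2).const_mul _)

theorem continuous_objective (x : E n) : Continuous (objective p x) := by
  unfold objective
  fun_prop

/-- `Q` is uniformly positive definite in a neighbourhood of each point. -/
theorem exists_eventually_le_inner_Q {x : E n} (hx : x ∈ X) :
    ∃ lam > 0, ∀ᶠ y in 𝓝[X] x, ∀ u : E m, lam * ‖u‖ ^ 2 ≤ inner ℝ u (p.Q y u) := by
  obtain ⟨lam, hlam, hQ⟩ : ∃ lam > 0, ∀ u : E m, lam * ‖u‖ ^ 2 ≤ inner ℝ u (p.Q x u) := by
    obtain ⟨lam, hlam, H⟩ := (isCompact_sphere (0 : E m) 1).exists_forall_le' (a := (0 : ℝ))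
      (f := fun u => inner ℝ u (p.Q x u)) (by fun_prop)
      (fun u hu => p.Q_posDef x hx u (ne_zero_of_mem_unit_sphere ⟨u, hu⟩))
    refine ⟨lam, hlam, fun u => ?_⟩
    by_cases hu : u = 0
    · simp [hu]
    have hn : ‖u‖ ≠ 0 := norm_ne_zero_iff.2 hu
    have h1 := H (‖u‖⁻¹ • u) (by simp [norm_smul, hn])
    simp only [map_smul, real_inner_smul_left, real_inner_smul_right] at h1
    calc lam * ‖u‖ ^ 2 ≤ (‖u‖⁻¹ * (‖u‖⁻¹ * inner ℝ u (p.Q x u))) * ‖u‖ ^ 2 := by gcongr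
      _ = _ := by field_simp
  obtain ⟨K, hK⟩ := p.Q_lipschitz
  refine ⟨lam / 2, by positivity, ?_⟩
  have h1 : Tendsto (fun y => ‖p.Q y - p.Q x‖) (𝓝[X] x) (𝓝 0) :=
    tendsto_iff_norm_sub_tendsto_zero.1 (hK.continuousOn x hx)
  filter_upwards [h1.eventually_lt_const (half_pos hlam)] with y hy u
  have h2 : |inner ℝ u ((p.Q y - p.Q x) u)| ≤ lam / 2 * ‖u‖ ^ 2 := by
    calc _ ≤ ‖u‖ * ‖(p.Q y - p.Q x) u‖ := abs_real_inner_le_norm _ _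
      _ ≤ ‖u‖ * (‖p.Q y - p.Q x‖ * ‖u‖) := by gcongr; exact ContinuousLinearMap.le_opNorm _ _
      _ ≤ ‖u‖ * (lam / 2 * ‖u‖) := by gcongr
      _ = _ := by ring
  have h3 : inner ℝ u (p.Q y u) = inner ℝ u (p.Q x u) + inner ℝ u ((p.Q y - p.Q x) u) := by
    rw [← inner_add_right]; simp
  have h4 := neg_le_of_abs_le h2
  have h5 := hQ u
  rw [h3]
  linarith

/-- Sublevel sets of the objective are locally uniformly bounded. -/
theorem exists_eventually_norm_le_of_objective_le {x : E n} (hx : x ∈ X) (B : ℝ) :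
    ∃ R, ∀ᶠ y in 𝓝[X] x, ∀ z, objective p y z ≤ B → ‖z‖ ≤ R := by
  obtain ⟨lam, hlam, hQ⟩ := exists_eventually_le_inner_Q p hx
  obtain ⟨K, hK⟩ := p.b_lipschitz
  have hb : ∀ᶠ y in 𝓝[X] x, ‖p.b y‖ < ‖p.b x‖ + 1 :=
    (hK.continuousOn x hx).norm.tendsto.eventually_lt_const (by linarith)
  set β := ‖p.b x‖ + 1 with hβ
  have hqα := p.qα_pos
  have hqM := p.qM_pos
  set B' := B + β ^ 2 / (2 * lam) with hB'
  refine ⟨max (√(B' / (lam / 2))) (max (√(B' / p.qα)) (√(B' / p.qM))), ?_⟩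
  filter_upwards [hQ, hb] with y hy hby z hz
  have h1 := hy z.1
  have h2 : -(β * ‖z.1‖) ≤ inner ℝ (p.b y) z.1 := by
    refine neg_le_of_abs_le ((abs_real_inner_le_norm _ _).trans ?_)
    gcongr
  -- Young's inequality: half of the quadratic term absorbs the linear one, and the remainder is the
  -- constant added to `B` in `B'`.
  have h3 : β * ‖z.1‖ ≤ lam / 2 * ‖z.1‖ ^ 2 + β ^ 2 / (2 * lam) := by
    have h : lam / 2 * ‖z.1‖ ^ 2 + β ^ 2 / (2 * lam) - β * ‖z.1‖
        = (lam * ‖z.1‖ - β) ^ 2 / (2 * lam) := by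
      field_simp
      ring
    have : 0 ≤ (lam * ‖z.1‖ - β) ^ 2 / (2 * lam) := by positivity
    linarith
  have h4 : lam / 2 * ‖z.1‖ ^ 2 + p.qα * z.2.1 ^ 2 + p.qM * z.2.2 ^ 2 ≤ B' := by
    unfold objective at hz
    linarith
  have e1 : 0 ≤ lam / 2 * ‖z.1‖ ^ 2 := by positivity
  have e2 : 0 ≤ p.qα * z.2.1 ^ 2 := by positivity
  have e3 : 0 ≤ p.qM * z.2.2 ^ 2 := by positivity
  have key : ∀ q a : ℝ, 0 < q → q * a ^ 2 ≤ B' → |a| ≤ √(B' / q) := fun q a hq h =>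
    Real.abs_le_sqrt ((le_div_iff₀ hq).2 (by linarith))
  have k1 := key _ ‖z.1‖ (half_pos hlam) (by linarith)
  rw [abs_norm] at k1
  exact max_le_max k1 (max_le_max (key _ z.2.1 hqα (by linarith)) (key _ z.2.2 hqM (by linarith)))

/-- The objective is strictly midpoint convex. -/
theorem objective_midpoint_lt {x : E n} (hx : x ∈ X) {z w : E m × ℝ × ℝ} (hzw : z ≠ w) :
    objective p x ((2⁻¹ : ℝ) • (z + w)) < (objective p x z + objective p x w) / 2 := by
  -- Parallelogram identity: the midpoint gap is a quarter of the quadratic part at `z - w`.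
  -- Symmetry of `Q` is not needed.
  have e : (objective p x z + objective p x w) / 2 - objective p x ((2⁻¹ : ℝ) • (z + w))
      = (inner ℝ (z.1 - w.1) (p.Q x (z.1 - w.1)) + p.qα * (z.2.1 - w.2.1) ^ 2
        + p.qM * (z.2.2 - w.2.2) ^ 2) / 4 := by
    simp only [objective, Prod.smul_fst, Prod.smul_snd, Prod.fst_add, Prod.snd_add, map_smul,
      map_add, map_sub, inner_add_left, inner_add_right, inner_sub_left, inner_sub_right,
      real_inner_smul_left, real_inner_smul_right, smul_eq_mul]
    ring
  have hα := p.qα_pos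
  have hM := p.qM_pos
  have hpos : 0 < inner ℝ (z.1 - w.1) (p.Q x (z.1 - w.1)) + p.qα * (z.2.1 - w.2.1) ^ 2
        + p.qM * (z.2.2 - w.2.2) ^ 2 := by
    have e2 : 0 ≤ p.qα * (z.2.1 - w.2.1) ^ 2 := by positivity
    have e3 : 0 ≤ p.qM * (z.2.2 - w.2.2) ^ 2 := by positivity
    by_cases h1 : z.1 = w.1
    · by_cases h2 : z.2.1 = w.2.1
      · have h3 : z.2.2 - w.2.2 ≠ 0 := fun h3 =>
          hzw (Prod.ext h1 (Prod.ext h2 (sub_eq_zero.1 h3)))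
        have : 0 < p.qM * (z.2.2 - w.2.2) ^ 2 := by positivity
        simp only [h1, sub_self, inner_zero_left]
        linarith
      · have h3 : z.2.1 - w.2.1 ≠ 0 := sub_ne_zero.2 h2
        have : 0 < p.qα * (z.2.1 - w.2.1) ^ 2 := by positivity
        simp only [h1, sub_self, inner_zero_left]
        linarith
    · have := p.Q_posDef x hx _ (sub_ne_zero.2 h1)
      linarith
  linarith

end Objective

end AdaptiveQP

/-! ### Existence, uniqueness and continuity of the minimizer -/

namespace AdaptiveQP

variable {n m ω r : ℕ} {L : Type*} [Fintype L] [Nonempty L]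
  {S : PiecewiseSystem n m ω} {c : Components n r L S.X} {p : QPParams n m S.X}

/-- The constraints are affine in `(u, α, M)`. -/
theorem constraint_combo (x : E n) (l : L) (i : Fin r) (z w : E m × ℝ × ℝ) {a b : ℝ}
    (hab : a + b = 1) :
    inner ℝ (gradient (c.h i) x) (S.f x + S.G x (a • z + b • w).1) + (a • z + b • w).2.1 * c.h i x
        + (a • z + b • w).2.2 * (c.hMax x - c.hMin l x) =
      a * (inner ℝ (gradient (c.h i) x) (S.f x + S.G x z.1) + z.2.1 * c.h i x
        + z.2.2 * (c.hMax x - c.hMin l x)) +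
      b * (inner ℝ (gradient (c.h i) x) (S.f x + S.G x w.1) + w.2.1 * c.h i x
        + w.2.2 * (c.hMax x - c.hMin l x)) := by
  have : S.f x = a • S.f x + b • S.f x := by rw [← add_smul, hab, one_smul]
  simp only [Prod.smul_fst, Prod.smul_snd, Prod.fst_add, Prod.snd_add, map_smul, map_add,
    inner_add_right, real_inner_smul_right, smul_eq_mul]
  have h2 := congrArg (inner ℝ (gradient (c.h i) x)) this
  rw [inner_add_right, real_inner_smul_right, real_inner_smul_right] at h2
  linear_combination h2

theorem convex_feasibleSet (x : E n) : Convex ℝ (feasibleSet S c p x) := by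
  rintro z ⟨h1, h2, h3, h4⟩ w ⟨k1, k2, k3, k4⟩ a b ha hb hab
  refine ⟨S.U_convex h1 k1 ha hb hab, ?_, ?_, fun l i hi => ?_⟩
  · exact convex_Ici p.cα h2 k2 ha hb hab
  · exact convex_Ici p.cM h3 k3 ha hb hab
  · rw [constraint_combo x l i z w hab]
    exact add_nonneg (mul_nonneg ha (h4 l i hi)) (mul_nonneg hb (k4 l i hi))

theorem isClosed_feasibleSet (x : E n) : IsClosed (feasibleSet S c p x) := by
  have : feasibleSet S c p x = (Prod.fst ⁻¹' S.U) ∩ {z | p.cα ≤ z.2.1} ∩ {z | p.cM ≤ z.2.2} ∩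
      ⋂ l, ⋂ i ∈ c.I l, {z : E m × ℝ × ℝ |
        0 ≤ inner ℝ (gradient (c.h i) x) (S.f x + S.G x z.1) + z.2.1 * c.h i x
          + z.2.2 * (c.hMax x - c.hMin l x)} := by
    ext z
    simp [feasibleSet, and_assoc]
  rw [this]
  refine (((S.U_closed.preimage continuous_fst).inter ?_).inter ?_).inter ?_
  · exact isClosed_le continuous_const (by fun_prop)
  · exact isClosed_le continuous_const (by fun_prop)
  · exact isClosed_iInter fun l => isClosed_iInter fun i => isClosed_iInter fun _ =>
      isClosed_le continuous_const (by fun_prop)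

theorem existsUnique_mem_solutionSet {x : E n} (hx : x ∈ S.X)
    (hne : (feasibleSet S c p x).Nonempty) : ∃! z, z ∈ solutionSet S c p x := by
  obtain ⟨z₀, hz₀⟩ := hne
  obtain ⟨R, hR⟩ := exists_eventually_norm_le_of_objective_le p hx (objective p x z₀)
  have hR := hR.self_of_nhdsWithin hx
  have hcomp : IsCompact (feasibleSet S c p x ∩ {z | objective p x z ≤ objective p x z₀}) := by
    refine (isCompact_closedBall (0 : E m × ℝ × ℝ) R).of_isClosed_subset
      ((isClosed_feasibleSet x).inter (isClosed_le (continuous_objective p x) continuous_const))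
      fun z hz => ?_
    rw [mem_closedBall_zero_iff]
    exact hR z hz.2
  obtain ⟨z, hz, hmin⟩ := hcomp.exists_isMinOn ⟨z₀, hz₀, le_refl (objective p x z₀)⟩
    (continuous_objective p x).continuousOn
  refine ⟨z, ⟨hz.1, fun z' hz' => ?_⟩, fun w hw => ?_⟩
  · by_cases h : objective p x z' ≤ objective p x z₀
    · exact hmin ⟨hz', h⟩
    · exact le_trans hz.2 (not_le.1 h).le
  · by_contra hwz
    have h1 := objective_midpoint_lt p hx hwz
    have h2 : (2⁻¹ : ℝ) • (w + z) ∈ feasibleSet S c p x := by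
      rw [smul_add]
      exact convex_feasibleSet x hw.1 hz.1 (by norm_num) (by norm_num) (by norm_num)
    have h3 := hw.2 _ h2
    have h4 := hw.2 _ hz.1
    by_cases h : objective p x ((2⁻¹ : ℝ) • (w + z)) ≤ objective p x z₀
    · have : objective p x z ≤ objective p x ((2⁻¹ : ℝ) • (w + z)) := hmin ⟨h2, h⟩
      linarith
    · have h5 : objective p x z ≤ objective p x z₀ := hz.2
      linarith

/-- Solutions are locally bounded around points with a strictly feasible triple. -/
theorem StrictlyFeasible.exists_eventually_norm_le {x : E n} (hx : x ∈ S.X) {z₀ : E m × ℝ × ℝ}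
    (hz₀ : StrictlyFeasible S c p x z₀) :
    ∃ R, ∀ᶠ y in 𝓝[S.X] x, ∀ z ∈ solutionSet S c p y, ‖z‖ ≤ R := by
  obtain ⟨R, hR⟩ := exists_eventually_norm_le_of_objective_le p hx (objective p x z₀ + 1)
  refine ⟨R, ?_⟩
  have h1 := tendsto_objective p hx (F := 𝓝[S.X] x) le_rfl (tendsto_const_nhds (x := z₀))
  filter_upwards [hR, hz₀.eventually hx, h1.eventually_lt_const (lt_add_one _),
    self_mem_nhdsWithin] with y hy hf hlt hyX z hz
  exact hy z ((hz.2 z₀ (hf.mem_feasibleSet hyX)).trans hlt.le)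

/-- The solution depends continuously on the state where `f` and `G` are continuous. -/
theorem StrictlyFeasible.tendsto_solution {x : E n} (hx : x ∈ S.X) {z₀ : E m × ℝ × ℝ}
    (hz₀ : StrictlyFeasible S c p x z₀) (hf : ContinuousWithinAt S.f S.X x)
    (hG : ContinuousWithinAt S.G S.X x) {ζ : E n → E m × ℝ × ℝ}
    (hζ : ∀ᶠ y in 𝓝[S.X] x, ζ y ∈ solutionSet S c p y) :
    Tendsto ζ (𝓝[S.X] x) (𝓝 (ζ x)) := by
  obtain ⟨R, hR⟩ := hz₀.exists_eventually_norm_le hx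
  have hmem : ∀ᶠ y in 𝓝[S.X] x, ζ y ∈ Metric.closedBall (0 : E m × ℝ × ℝ) R := by
    filter_upwards [hζ, hR] with y hy hRy
    exact mem_closedBall_zero_iff.2 (hRy _ hy)
  -- It suffices that every cluster point `z` of the minimizers is a minimizer at `x`, hence equal
  -- to `ζ x`.
  refine (isCompact_closedBall _ _).tendsto_nhds_of_unique_mapClusterPt hmem fun z _ hz => ?_
  obtain ⟨F, hF, hFz⟩ := mapClusterPt_iff_ultrafilter.1 hz
  have hF' : (F : Filter (E n)) ≤ 𝓝 x := hF.trans nhdsWithin_le_nhds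
  have hζF : ∀ᶠ y in F, ζ y ∈ solutionSet S c p y := hF hζ
  have h1 : Tendsto (fun y => (ζ y).1) F (𝓝 z.1) := (continuous_fst.tendsto z).comp hFz
  have h2 : Tendsto (fun y => (ζ y).2.1) F (𝓝 z.2.1) :=
    ((continuous_fst.comp continuous_snd).tendsto z).comp hFz
  have h3 : Tendsto (fun y => (ζ y).2.2) F (𝓝 z.2.2) :=
    ((continuous_snd.comp continuous_snd).tendsto z).comp hFz
  have hfeas : z ∈ feasibleSet S c p x := by
    refine ⟨S.U_closed.mem_of_tendsto h1 (hζF.mono fun y hy => hy.1.1),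
      ge_of_tendsto h2 (hζF.mono fun y hy => hy.1.2.1),
      ge_of_tendsto h3 (hζF.mono fun y hy => hy.1.2.2.1), fun l i hi => ?_⟩
    exact ge_of_tendsto (tendsto_constraint hx hF'
      ((hf.tendsto.mono_left hF).add (tendsto_clm_apply (hG.tendsto.mono_left hF) h1)) h2 h3)
      (hζF.mono fun y hy => hy.1.2.2.2 l i hi)
  have hopt : ∀ z' ∈ feasibleSet S c p x, objective p x z ≤ objective p x z' := by
    intro z' hz'
    -- A competitor `z'` at `x` may be infeasible nearby. Moved towards `z₀`, it satisfies the
    -- constraints strictly at `x` and so stays feasible nearby; afterwards `s → 0`.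
    have hs : ∀ s ∈ Ioc (0 : ℝ) 1, objective p x z ≤ objective p x ((1 - s) • z' + s • z₀) := by
      intro s hs
      have hev : ∀ᶠ y in 𝓝[S.X] x, (1 - s) • z' + s • z₀ ∈ feasibleSet S c p y := by
        have hpos : ∀ᶠ y in 𝓝[S.X] x, ∀ l, ∀ i, i ∈ c.I l →
            0 ≤ inner ℝ (gradient (c.h i) y) (S.f y + S.G y ((1 - s) • z' + s • z₀).1)
              + ((1 - s) • z' + s • z₀).2.1 * c.h i y
              + ((1 - s) • z' + s • z₀).2.2 * (c.hMax y - c.hMin l y) := by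
          refine eventually_all.2 fun l => eventually_all.2 fun i => ?_
          by_cases hi : i ∈ c.I l
          · have hlim := tendsto_constraint (c := c) hx (l := l) (i := i) nhdsWithin_le_nhds
              (hf.tendsto.add (tendsto_clm_apply hG.tendsto
                (tendsto_const_nhds (x := ((1 - s) • z' + s • z₀).1))))
              (tendsto_const_nhds (x := ((1 - s) • z' + s • z₀).2.1))
              (tendsto_const_nhds (x := ((1 - s) • z' + s • z₀).2.2))
            rw [constraint_combo x l i z' z₀ (sub_add_cancel 1 s)] at hlim
            have hgt := add_pos_of_nonneg_of_pos
              (mul_nonneg (sub_nonneg.2 hs.2) (hz'.2.2.2 l i hi))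
              (mul_pos hs.1 (hz₀.pos hx hi))
            exact (hlim.eventually_const_lt hgt).mono fun y hy _ => hy.le
          · exact Eventually.of_forall fun _ h => absurd h hi
        have hx0 := convex_feasibleSet x hz' (hz₀.mem_feasibleSet hx) (sub_nonneg.2 hs.2) hs.1.le
          (sub_add_cancel 1 s)
        exact hpos.mono fun y hy => ⟨hx0.1, hx0.2.1, hx0.2.2.1, hy⟩
      refine le_of_tendsto_of_tendsto (tendsto_objective p hx hF hFz)
        (tendsto_objective p hx hF (tendsto_const_nhds (x := (1 - s) • z' + s • z₀))) ?_
      filter_upwards [hζF, hF hev] with y hy hy'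
      exact hy.2 _ hy'
    have hcont : Continuous fun s : ℝ => objective p x ((1 - s) • z' + s • z₀) :=
      (continuous_objective p x).comp (by fun_prop)
    have hlim : Tendsto (fun s : ℝ => objective p x ((1 - s) • z' + s • z₀)) (𝓝[>] 0)
        (𝓝 (objective p x z')) := by
      simpa using (hcont.tendsto 0).mono_left nhdsWithin_le_nhds
    exact ge_of_tendsto hlim
      (eventually_of_mem (Ioc_mem_nhdsGT zero_lt_one) hs)
  exact (existsUnique_mem_solutionSet hx ⟨z, hfeas⟩).unique ⟨hfeas, hopt⟩
    (hζ.self_of_nhdsWithin hx)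

end AdaptiveQP

/-! ### Filippov velocities and safety -/

namespace AdaptiveQP

variable {n m ω r : ℕ} {L : Type*} [Fintype L] [Nonempty L]
  {S : PiecewiseSystem n m ω} {c : Components n r L S.X} {p : QPParams n m S.X}

/-- Lower bounds of a linear functional on the vector field near `x` pass to the Filippov map. -/
theorem le_inner_of_mem_filippovMap {X : Set (E n)} {V : E n → E n} {x g v : E n} {a : ℝ}
    (h : ∀ᶠ y in 𝓝[X] x, a ≤ inner ℝ g (V y)) (hv : v ∈ filippovMap X V x) :
    a ≤ inner ℝ g v := by
  obtain ⟨δ, hδ, H⟩ := Metric.mem_nhdsWithin_iff.1 h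
  simp only [filippovMap, mem_iInter] at hv
  -- The bound holds at every nearby point of `X`, so no null set need be removed.
  have h1 := hv δ hδ ∅ measure_empty
  have hconv : Convex ℝ {w : E n | a ≤ inner ℝ g w} :=
    convex_halfSpace_ge (innerₛₗ ℝ g).isLinear a
  have hcl : IsClosed {w : E n | a ≤ inner ℝ g w} :=
    isClosed_le continuous_const (by fun_prop)
  refine closure_minimal (convexHull_min ?_ hconv) hcl h1
  rintro _ ⟨y, hy, rfl⟩
  exact H hy.1

theorem PiecewiseSystem.exists_eventually_norm_le (S : PiecewiseSystem n m ω) {x : E n}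
    (hx : x ∈ S.X) : ∃ B, ∀ᶠ y in 𝓝[S.X] x, ‖S.f y‖ ≤ B ∧ ‖S.G y‖ ≤ B := by
  refine ⟨∑ j, (‖S.fPiece j x‖ + ‖S.GPiece j x‖ + 1), ?_⟩
  have h : ∀ᶠ y in 𝓝[S.X] x, ∀ j, ‖S.fPiece j y‖ < ‖S.fPiece j x‖ + 1 ∧
      ‖S.GPiece j y‖ < ‖S.GPiece j x‖ + 1 := eventually_all.2 fun j =>
    ((S.fPiece_continuous j x hx).norm.tendsto.eventually_lt_const (lt_add_one _)).and
      ((S.GPiece_continuous j x hx).norm.tendsto.eventually_lt_const (lt_add_one _))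
  filter_upwards [h, self_mem_nhdsWithin] with y hy hyX
  obtain ⟨j, -, hf, hG⟩ := S.eq_active y hyX
  have hj := Finset.single_le_sum
    (f := fun j => ‖S.fPiece j x‖ + ‖S.GPiece j x‖ + 1) (fun j _ => by positivity)
    (Finset.mem_univ j)
  have := hy j
  have h1 := norm_nonneg (S.fPiece j x)
  have h2 := norm_nonneg (S.GPiece j x)
  rw [hf, hG]
  constructor <;> linarith

/-- Outside the safe set, no Filippov velocity of the closed loop decreases an active component. -/
theorem StrictlyFeasible.inner_gradient_nonneg {x : E n} (hx : x ∈ S.X) {z₀ : E m × ℝ × ℝ}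
    (hz₀ : StrictlyFeasible S c p x z₀) {k : E n → E m}
    (hk : ∀ᶠ y in 𝓝[S.X] x, ∃ α M : ℝ, (k y, α, M) ∈ solutionSet S c p y)
    (hneg : c.hMax x < 0) {i : Fin r} (hi : i ∈ c.activeComp x) {v : E n}
    (hv : v ∈ filippovMap S.X (fun y => S.f y + S.G y (k y)) x) :
    0 ≤ inner ℝ (gradient (c.h i) x) v := by
  obtain ⟨l, hil, e1, e2⟩ := hi
  obtain ⟨R, hR⟩ := hz₀.exists_eventually_norm_le hx
  obtain ⟨B, hB⟩ := S.exists_eventually_norm_le hx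
  refine le_of_forall_lt fun a ha => ?_
  obtain ⟨b, hab, hb⟩ := exists_between ha
  refine hab.trans_le (le_inner_of_mem_filippovMap ?_ hv)
  -- The two errors are the `M`-term, which vanishes in the limit since `ℓ` attains `h` at `x`, and
  -- the cost of replacing `∇h_i(y)` by `∇h_i(x)`.
  have hlim : Tendsto (fun y => R * (c.hMax y - c.hMin l y)
      + ‖gradient (c.h i) y - gradient (c.h i) x‖ * (B + B * R)) (𝓝[S.X] x) (𝓝 0) := by
    have t1 := (c.continuousAt_hMax hx).sub (c.continuousAt_hMin hx l)
    have t2 := ((c.continuousAt_gradient hx i).sub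
      (continuousAt_const (y := gradient (c.h i) x))).norm
    have t := ((t1.const_mul R).add (t2.mul_const (B + B * R))).tendsto.mono_left
      (nhdsWithin_le_nhds (s := S.X))
    refine t.congr' EventuallyEq.rfl |>.trans (le_of_eq ?_)
    simp [e1]
  have hhi : ∀ᶠ y in 𝓝[S.X] x, c.h i y < 0 :=
    (((c.continuousAt_h hx i).tendsto.mono_left nhdsWithin_le_nhds).eventually_lt_const
      (by rw [← e2, ← e1]; exact hneg))
  filter_upwards [hlim.eventually_lt_const (neg_pos.2 hb), hhi, hk, hR, hB]
    with y hy hhy ⟨α, M, hs⟩ hRy ⟨hBf, hBG⟩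
  have hn := hRy _ hs
  have hku : ‖k y‖ ≤ R := (norm_fst_le _).trans hn
  have hMR : M ≤ R := (le_abs_self M).trans
    ((norm_snd_le (α, M)).trans ((norm_snd_le (k y, α, M)).trans hn))
  have hα : 0 ≤ α := p.cα_pos.le.trans hs.1.2.1
  have hV : ‖S.f y + S.G y (k y)‖ ≤ B + B * R := by
    refine (norm_add_le _ _).trans (add_le_add hBf ?_)
    exact ((S.G y).le_opNorm _).trans
      (mul_le_mul hBG hku (norm_nonneg _) ((norm_nonneg _).trans hBG))
  have hc := hs.1.2.2.2 l i hil
  simp only at hc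
  have hd : 0 ≤ c.hMax y - c.hMin l y := sub_nonneg.2 (c.hMin_le_hMax l y)
  have hd' : M * (c.hMax y - c.hMin l y) ≤ R * (c.hMax y - c.hMin l y) := by gcongr
  have hαh : α * c.h i y ≤ 0 := mul_nonpos_of_nonneg_of_nonpos hα hhy.le
  have hdiff : inner ℝ (gradient (c.h i) y - gradient (c.h i) x) (S.f y + S.G y (k y))
      ≤ ‖gradient (c.h i) y - gradient (c.h i) x‖ * (B + B * R) :=
    (real_inner_le_norm _ _).trans (by gcongr)
  rw [inner_sub_left] at hdiff
  linarith

/-- A curve along which `h` does not decrease outside the safe set does not leave the safe set from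
its boundary. -/
theorem Components.not_leavesAt_of_deriv_nonneg {X : Set (E n)} (c : Components n r L X)
    {φ : ℝ → E n} {t t₁ : ℝ} (ht : t < t₁) (hφX : ∀ s ∈ Icc t t₁, φ s ∈ X)
    (hφ : AbsolutelyContinuousOnInterval φ t t₁) (h0 : 0 ≤ c.hMax (φ t))
    {A : Set (E n)} (hA : A ∈ 𝓝 (φ t))
    (hder : ∀ᵐ s, s ∈ Ioo t t₁ → φ s ∈ A → c.hMax (φ s) < 0 →
      0 ≤ deriv (c.hMax ∘ φ) s) : ¬ LeavesAt φ c.safeSet t := by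
  obtain ⟨K, B, hB, hK⟩ := c.exists_lipschitzOnWith_hMax (hφX t ⟨le_rfl, ht.le⟩)
  have hcont : ContinuousOn φ (Icc t t₁) := by
    have := hφ.continuousOn
    rwa [uIcc_of_le ht.le] at this
  have hev : ∀ᶠ s in 𝓝[≥] t, φ s ∈ A ∩ B := by
    have := (hcont t ⟨le_rfl, ht.le⟩).eventually_mem (inter_mem hA hB)
    rwa [nhdsWithin_Icc_eq_nhdsGE ht] at this
  obtain ⟨τ, hτ, hτAB⟩ := (mem_nhdsGE_iff_exists_mem_Ioc_Ico_subset ht).1 hev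
  unfold LeavesAt
  rw [not_frequently]
  filter_upwards [Ioo_mem_nhdsGT hτ.1] with s hs
  rw [not_not, c.mem_safeSet]
  have hst : s ∈ Icc t t₁ := ⟨hs.1.le, hs.2.le.trans hτ.2⟩
  refine ⟨hφX s hst, ?_⟩
  by_contra! hneg
  have hsub : ∀ a ∈ Icc t s, φ a ∈ A ∩ B := fun a ha => hτAB ⟨ha.1, ha.2.trans_lt hs.2⟩
  have hg : AbsolutelyContinuousOnInterval (c.hMax ∘ φ) t s := by
    refine hK.comp_absolutelyContinuousOnInterval (hφ.mono ?_) ?_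
    · rw [uIcc_of_le hs.1.le, uIcc_of_le ht.le]
      exact Icc_subset_Icc_right hst.2
    · rw [uIcc_of_le hs.1.le]
      exact fun a ha => (hsub a ha).2
  have hgc : ContinuousOn (c.hMax ∘ φ) (Icc t s) := by
    have := hg.continuousOn
    rwa [uIcc_of_le hs.1.le] at this
  have hZc : IsCompact (Icc t s ∩ (c.hMax ∘ φ) ⁻¹' Ici 0) :=
    isCompact_Icc.of_isClosed_subset (hgc.preimage_isClosed_of_isClosed isClosed_Icc isClosed_Ici)
      inter_subset_left
  -- After the last time `a` in `[t, s]` with `h ≥ 0`, the function `h ∘ φ` is negative, hence does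
  -- not decrease, which contradicts `h < 0` at `s`.
  obtain ⟨a, ⟨haI, ha0⟩, hamax⟩ := hZc.exists_isGreatest ⟨t, ⟨le_rfl, hs.1.le⟩, h0⟩
  have hle : (c.hMax ∘ φ) a ≤ (c.hMax ∘ φ) s := by
    refine (hg.mono ?_).le_of_ae_deriv_nonneg haI.2 ?_
    · rw [uIcc_of_le haI.2, uIcc_of_le hs.1.le]
      exact Icc_subset_Icc_left haI.1
    · filter_upwards [hder] with w hw hwI
      have hwt : w ∈ Icc t s := ⟨haI.1.trans hwI.1.le, hwI.2.le⟩
      refine hw ⟨haI.1.trans_lt hwI.1, hwI.2.trans_le hst.2⟩ (hsub w hwt).1 ?_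
      by_contra! hw0
      exact absurd (hamax ⟨hwt, hw0⟩) (not_le.2 hwI.1)
  have ha0' : 0 ≤ (c.hMax ∘ φ) a := ha0
  have hneg' : (c.hMax ∘ φ) s < 0 := hneg
  linarith

end AdaptiveQP

/-! ### The main theorem -/

theorem mainTheorem3 {n m ω r : ℕ} {L : Type*} [Fintype L] [Nonempty L]
    (S : AdaptiveQP.PiecewiseSystem n m ω) (c : AdaptiveQP.Components n r L S.X)
    (p : AdaptiveQP.QPParams n m S.X)
    (hcompact : IsCompact (frontier c.safeSet))
    (hzero : ∀ x ∈ S.X, c.hMax x = 0 → x ∈ frontier c.safeSet)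
    (hcbf : AdaptiveQP.Components.CBFCondition S c)
    (D : Set (AdaptiveQP.E n)) (hD : IsCompact D) (hDC : D ⊆ c.safeSet) :
    ∃ N : Set (AdaptiveQP.E n), IsOpen N ∧ D ⊆ N ∧
      (∀ x ∈ N ∩ S.X, (AdaptiveQP.feasibleSet S c p x).Nonempty) ∧
      (∀ x ∈ N ∩ S.X, ∃! z, z ∈ AdaptiveQP.solutionSet S c p x) ∧
      (∀ k : AdaptiveQP.E n → AdaptiveQP.E m,
        AdaptiveQP.IsAdaptiveController S c p (N ∩ S.X) k →
        (∀ x ∈ N ∩ S.X, ContinuousWithinAt S.f S.X x → ContinuousWithinAt S.G S.X x →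
          ContinuousWithinAt k S.X x) ∧
        (∀ (φ : ℝ → AdaptiveQP.E n) (t₀ t₁ : ℝ),
          AdaptiveQP.IsFilippovSolution S.X (fun x => S.f x + S.G x (k x)) φ t₀ t₁ →
          ∀ t ∈ Ico t₀ t₁, φ t ∈ D → ¬ AdaptiveQP.LeavesAt φ c.safeSet t)) := by
  -- Strict feasibility is open only relative to `X`; the implication makes the condition void off
  -- `X`, so that the interior can be taken in the whole space.
  let N : Set (AdaptiveQP.E n) :=
    interior {y | y ∈ S.X → ∃ z, AdaptiveQP.StrictlyFeasible S c p y z}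
  have hN : ∀ x ∈ N ∩ S.X, ∃ z, AdaptiveQP.StrictlyFeasible S c p x z := fun x hx =>
    interior_subset hx.1 hx.2
  have hDN : D ⊆ N := fun x hx => by
    obtain ⟨z, hz⟩ := AdaptiveQP.exists_strictlyFeasible (p := p) hzero hcbf (hDC hx)
    have := hz.eventually ((c.mem_safeSet x).1 (hDC hx)).1
    rw [eventually_nhdsWithin_iff] at this
    exact mem_interior_iff_mem_nhds.2 (this.mono fun y hy hyX => ⟨z, hy hyX⟩)
  have hfeas : ∀ x ∈ N ∩ S.X, (AdaptiveQP.feasibleSet S c p x).Nonempty := fun x hx => by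
    obtain ⟨z, hz⟩ := hN x hx
    exact ⟨z, hz.mem_feasibleSet hx.2⟩
  refine ⟨N, isOpen_interior, hDN, hfeas,
    fun x hx => AdaptiveQP.existsUnique_mem_solutionSet hx.2 (hfeas x hx), fun k hk => ?_⟩
  have hNmem : ∀ x ∈ N, ∀ᶠ y in 𝓝[S.X] x, y ∈ N ∩ S.X := fun x hx =>
    inter_mem (mem_nhdsWithin_of_mem_nhds (isOpen_interior.mem_nhds hx)) self_mem_nhdsWithin
  refine ⟨fun x hx hf hG => ?_, fun φ t₀ t₁ hφ t ht htD => ?_⟩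
  · obtain ⟨z, hz⟩ := hN x hx
    choose! α M hαM using hk
    have := hz.tendsto_solution hx.2 hf hG (ζ := fun y => (k y, α y, M y))
      ((hNmem x hx.1).mono hαM)
    exact (continuous_fst.tendsto _).comp this
  · have hsub : Icc t t₁ ⊆ Icc t₀ t₁ := Icc_subset_Icc_left ht.1
    have hAC : AbsolutelyContinuousOnInterval φ t t₁ := hφ.absolutelyContinuous.mono (by
      rw [uIcc_of_le ht.2.le, uIcc_of_le hφ.lt.le]
      exact hsub)
    refine c.not_leavesAt_of_deriv_nonneg ht.2 (fun s hs => hφ.mem s (hsub hs)) hAC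
      ((c.mem_safeSet _).1 (hDC htD)).2 (isOpen_interior.mem_nhds (hDN htD)) ?_
    filter_upwards [hφ.deriv_mem] with s hs hsI hsN hneg
    obtain ⟨v, hv, hder⟩ := hs (hsub (Ioo_subset_Icc_self hsI))
    have hsX : φ s ∈ S.X := hφ.mem s (hsub (Ioo_subset_Icc_self hsI))
    by_cases hdiff : DifferentiableAt ℝ (c.hMax ∘ φ) s
    · obtain ⟨i, hi, hi'⟩ := c.exists_activeComp_hasDerivAt hsX hder hdiff.hasDerivAt
      obtain ⟨z, hz⟩ := hN _ ⟨hsN, hsX⟩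
      rw [hi']
      exact hz.inner_gradient_nonneg hsX ((hNmem _ hsN).mono hk) hneg hi hv
    -- At other times `deriv` has the default value `0`.
    · exact (deriv_zero_of_not_differentiableAt hdiff).ge
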